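/- Let $n\ge 1$ and let $M$ be a non-empty smooth manifold of dimension $2n+1$ with an almost contact metric structure $(\phi,\xi,\eta,g)$: $g$ is a Riemannian metric, $\phi$ a smooth $(1,1)$-tensor field, $\xi$ a smooth vector field, $\eta=g(\cdot,\xi)$, and $$\phi^2X=-X+\eta(X)\xi,\quad \eta(\xi)=1,\quad \phi\xi=0,\quad \eta\circ\phi=0,\quad g(\phi X,\phi Y)=g(X,Y)-\eta(X)\eta(Y).$$ Let $R(X,Y)Z=\nabla_X\nabla_YZ-\nabla_Y\nabla_XZ-\nabla_{[X,Y]}Z$ be the curvature tensor of the Levi-Civita connection $\nabla$ of $g$, $S(Y,Z)=\operatorname{tr}(X\mapsto R(X,Y)Z)$ the Ricci tensor, $Q$ the Ricci operator ($g(QX,Y)=S(X,Y)$), $r=\operatorname{tr}Q$ the scalar curvature, $\Phi(X,Y)=g(X,\phi Y)$ and $h=\tfrac12\pounds_\xi\phi$. Suppose that $M$ is a $(k,\mu)$-almost Kenmotsu manifold for some constants $k,\mu\in\mathbb R$, that is, $d\eta=0$, $d\Phi=2\eta\wedge\Phi$ and, for all $X,Y$, $$R(X,Y)\xi=k[\eta(Y)X-\eta(X)Y]+\mu[\eta(Y)hX-\eta(X)hY].$$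 Suppose further that $M$ admits a proper Ricci–Yamabe soliton $(g,\xi,\lambda,\alpha,\beta)$ with potential vector field $\xi$, that is, there are $\lambda,\alpha,\beta\in\mathbb R$ with $\alpha\ne 0$ and $\alpha\neq 1$ such that $$\pounds_\xi g+2\alpha S=(2\lambda-\beta r)g .$$ Then the curvature condition $Q\cdot R=0$ does not hold on $M$; that is, it is not the case that $$Q(R(X,Y)Z)-R(QX,Y)Z-R(X,QY)Z-R(X,Y)QZ=0$$ for all vector fields $X,Y,Z$ on $M$. -/

import Mathlib

set_option maxSynthPendingDepth 3

open scoped Manifold ContDiff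

/-! ## Riemannian geometry in coordinates

`G : E → E →L[ℝ] E →L[ℝ] ℝ` is the coordinate expression of a metric; all tensors are evaluated
at a point `x` of the coordinate domain on vectors of the coordinate space `E`. -/

namespace CoordGeom

noncomputable section

variable {E : Type*} [NormedAddCommGroup E] [NormedSpace ℝ E]

/-- Christoffel symbols of the first kind,
`Γ(u, v; w) = (∂_u G(v, w) + ∂_v G(u, w) - ∂_w G(u, v)) / 2`. -/
def christoffelLower (G : E → E →L[ℝ] E →L[ℝ] ℝ) (x : E) : E →L[ℝ] E →L[ℝ] E →L[ℝ] ℝ :=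
  (1 / 2 : ℝ) • (fderiv ℝ G x + (fderiv ℝ G x).flip
    - (ContinuousLinearMap.flipₗᵢ ℝ E E ℝ).toContinuousLinearEquiv.toContinuousLinearMap.comp
        (fderiv ℝ G x).flip)

theorem christoffelLower_apply (G : E → E →L[ℝ] E →L[ℝ] ℝ) (x u v w : E) :
    christoffelLower G x u v w =
      (1 / 2 : ℝ) * (fderiv ℝ G x u v w + fderiv ℝ G x v u w - fderiv ℝ G x w u v) := by
  simp [christoffelLower]

/-- The Levi-Civita connection in coordinates: Christoffel symbols of the second kind, `Γ(u, v)` is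
the vector with `G(Γ(u, v), w) = Γ(u, v; w)` for all `w`, so that `∇_u Y = ∂_u Y + Γ(u, Y)`.
Here `(G x).inverse` is the inverse of `v ↦ G x v ·`, that is, raising an index. -/
def christoffel (G : E → E →L[ℝ] E →L[ℝ] ℝ) (x : E) : E →L[ℝ] E →L[ℝ] E :=
  (ContinuousLinearMap.compL ℝ E (E →L[ℝ] ℝ) E (G x).inverse) ∘L christoffelLower G x

theorem christoffel_apply (G : E → E →L[ℝ] E →L[ℝ] ℝ) (x u v : E) :
    christoffel G x u v = (G x).inverse (christoffelLower G x u v) := rfl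

/-- Riemann curvature tensor, `R(u, v) w = ∇_u ∇_v w - ∇_v ∇_u w` for the constant coordinate
vector fields with values `u`, `v`, `w` (whose Lie brackets vanish). -/
def curvature (G : E → E →L[ℝ] E →L[ℝ] ℝ) (x u v w : E) : E :=
  (fderiv ℝ (christoffel G) x u v w + christoffel G x u (christoffel G x v w))
    - (fderiv ℝ (christoffel G) x v u w + christoffel G x v (christoffel G x u w))

/-- Ricci tensor `S(v, w) = trace (u ↦ R(u, v) w)`. -/
def ricci (G : E → E →L[ℝ] E →L[ℝ] ℝ) (x : E) : E →ₗ[ℝ] E →ₗ[ℝ] ℝ :=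
  LinearMap.mk₂ ℝ
    (fun v w => LinearMap.trace ℝ E
      { toFun := fun u => curvature G x u v w
        map_add' := fun a b => by simp only [curvature, map_add, add_apply]; abel
        map_smul' := fun c a => by
          simp only [curvature, map_smul, smul_apply, RingHom.id_apply,
            smul_sub, smul_add] })
    (fun a b w => by
      rw [← map_add]; congr 1; ext u
      simp only [curvature, map_add, add_apply, LinearMap.add_apply,
        LinearMap.coe_mk, AddHom.coe_mk]; abel)
    (fun c a w => by
      rw [← map_smul]; congr 1; ext u
      simp only [curvature, map_smul, smul_apply, LinearMap.smul_apply,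
        LinearMap.coe_mk, AddHom.coe_mk, smul_sub, smul_add])
    (fun v a b => by
      rw [← map_add]; congr 1; ext u
      simp only [curvature, map_add, LinearMap.add_apply, LinearMap.coe_mk, AddHom.coe_mk]; abel)
    (fun c v a => by
      rw [← map_smul]; congr 1; ext u
      simp only [curvature, map_smul, LinearMap.smul_apply, LinearMap.coe_mk, AddHom.coe_mk,
        smul_sub, smul_add])

/-- Ricci operator: `G(Q v, w) = S(v, w)`. -/
def ricciOp [FiniteDimensional ℝ E] (G : E → E →L[ℝ] E →L[ℝ] ℝ) (x : E) : E →ₗ[ℝ] E :=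
  ((G x).inverse : (E →L[ℝ] ℝ) →ₗ[ℝ] E) ∘ₗ
    (LinearMap.toContinuousLinearMap : (E →ₗ[ℝ] ℝ) ≃ₗ[ℝ] (E →L[ℝ] ℝ)).toLinearMap ∘ₗ ricci G x

/-- Scalar curvature `r = trace Q`. -/
def scalarCurvature [FiniteDimensional ℝ E] (G : E → E →L[ℝ] E →L[ℝ] ℝ) (x : E) : ℝ :=
  LinearMap.trace ℝ E (ricciOp G x)

/-- The curvature condition `Q · R = 0` at `x`:
`Q(R(u, v) w) - R(Q u, v) w - R(u, Q v) w - R(u, v) Q w = 0` for all `u`, `v`, `w`. -/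
def QdotRZero [FiniteDimensional ℝ E] (G : E → E →L[ℝ] E →L[ℝ] ℝ) (x : E) : Prop :=
  ∀ u v w : E, ricciOp G x (curvature G x u v w) - curvature G x (ricciOp G x u) v w
    - curvature G x u (ricciOp G x v) w - curvature G x u v (ricciOp G x w) = 0

/-- Lie derivative of a covariant 2-tensor, `(£_V G)(u, v)`. -/
def lieMetric (V : E → E) (G : E → E →L[ℝ] E →L[ℝ] ℝ) (x u v : E) : ℝ :=
  fderiv ℝ G x (V x) u v + G x (fderiv ℝ V x u) v + G x u (fderiv ℝ V x v)

/-- Lie derivative of a (1,1)-tensor: for constant `u` this is `[V, P u] - P [V, u]`. -/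
def lieEnd (V : E → E) (P : E → E →L[ℝ] E) (x : E) : E →L[ℝ] E :=
  fderiv ℝ P x (V x) - fderiv ℝ V x ∘L P x + P x ∘L fderiv ℝ V x

/-- A 1-form is closed at `x`: `dθ(u, v) = 0`. -/
def IsClosedOneForm (θ : E → E →L[ℝ] ℝ) (x : E) : Prop :=
  ∀ u v : E, fderiv ℝ θ x u v - fderiv ℝ θ x v u = 0

/-- Exterior derivative of a 2-form (given as a bilinear form). -/
def extDerivTwo (Ω : E → E →L[ℝ] E →L[ℝ] ℝ) (x u v w : E) : ℝ :=
  fderiv ℝ Ω x u v w + fderiv ℝ Ω x v w u + fderiv ℝ Ω x w u v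

/-- Wedge product of a 1-form and a 2-form. -/
def wedgeOneTwo (θ : E →L[ℝ] ℝ) (Ω : E →L[ℝ] E →L[ℝ] ℝ) (u v w : E) : ℝ :=
  θ u * Ω v w + θ v * Ω w u + θ w * Ω u v

end

end CoordGeom

/-! ## Tensor fields on a manifold and their coordinate expressions

The coordinate expressions are taken in the charts `extChartAt 𝓘(ℝ, E) c`, `c : M`; these cover
`M`, and a tensor identity holds on `M` exactly when it holds in each of them. -/

noncomputable section

/-- Smooth Riemannian metrics on `M`. -/
abbrev RMetric (E : Type*) [NormedAddCommGroup E] [NormedSpace ℝ E]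
    (M : Type*) [TopologicalSpace M] [ChartedSpace E M] [IsManifold 𝓘(ℝ, E) ∞ M] :=
  Bundle.ContMDiffRiemannianMetric 𝓘(ℝ, E) ∞ E (fun p : M => TangentSpace 𝓘(ℝ, E) p)

section Coordinates

variable {E : Type*} [NormedAddCommGroup E] [NormedSpace ℝ E]
  {M : Type*} [TopologicalSpace M] [ChartedSpace E M]

/-- The point of `M` with coordinates `x` in the chart at `c`. -/
def chartPoint (c : M) (x : E) : M := (extChartAt 𝓘(ℝ, E) c).symm x

/-- Differential at `x` of the inverse of the chart at `c`. -/
def fromCoord (c : M) (x : E) : E →L[ℝ] TangentSpace 𝓘(ℝ, E) (chartPoint c x) :=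
  mfderiv 𝓘(ℝ, E) 𝓘(ℝ, E) (extChartAt 𝓘(ℝ, E) c).symm x

/-- Differential of the chart at `c`, at the point with coordinates `x`. -/
def toCoord (c : M) (x : E) : TangentSpace 𝓘(ℝ, E) (chartPoint c x) →L[ℝ] E :=
  mfderiv 𝓘(ℝ, E) 𝓘(ℝ, E) (extChartAt 𝓘(ℝ, E) c) (chartPoint c x)

/-- Coordinate expression of a vector field. -/
def coordVec (V : ∀ p : M, TangentSpace 𝓘(ℝ, E) p) (c : M) (x : E) : E :=
  toCoord c x (V (chartPoint c x))

/-- Coordinate expression of a field of endomorphisms. -/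
def coordEnd (P : ∀ p : M, TangentSpace 𝓘(ℝ, E) p →L[ℝ] TangentSpace 𝓘(ℝ, E) p)
    (c : M) (x : E) : E →L[ℝ] E :=
  toCoord c x ∘L P (chartPoint c x) ∘L fromCoord c x

/-- Coordinate expression of a field of bilinear forms:
`(u, v) ↦ B(D u, D v)` with `D` the differential of the inverse chart. -/
def coordBilin (B : ∀ p : M, TangentSpace 𝓘(ℝ, E) p →L[ℝ] TangentSpace 𝓘(ℝ, E) p →L[ℝ] ℝ)
    (c : M) (x : E) : E →L[ℝ] E →L[ℝ] ℝ :=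
  (ContinuousLinearMap.precomp ℝ (fromCoord c x)) ∘L B (chartPoint c x) ∘L fromCoord c x

theorem coordBilin_apply
    (B : ∀ p : M, TangentSpace 𝓘(ℝ, E) p →L[ℝ] TangentSpace 𝓘(ℝ, E) p →L[ℝ] ℝ)
    (c : M) (x u v : E) :
    coordBilin B c x u v = B (chartPoint c x) (fromCoord c x u) (fromCoord c x v) := rfl

variable [IsManifold 𝓘(ℝ, E) ∞ M]

/-- Coordinate expression of a Riemannian metric. -/
def coordMetric (g : RMetric E M) (c : M) : E → E →L[ℝ] E →L[ℝ] ℝ := coordBilin g.inner c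

end Coordinates

/-! ## Ricci–Yamabe solitons and the condition `Q · R = 0` -/

section Soliton

variable {E : Type*} [NormedAddCommGroup E] [NormedSpace ℝ E] [FiniteDimensional ℝ E]
  {M : Type*} [TopologicalSpace M] [ChartedSpace E M] [IsManifold 𝓘(ℝ, E) ∞ M]

/-- `(g, V, lam, α, β)` is a Ricci–Yamabe soliton: `£_V g + 2 α S = (2 lam - β r) g`. -/
def IsRicciYamabeSoliton (g : RMetric E M) (V : ∀ p : M, TangentSpace 𝓘(ℝ, E) p)
    (lam α β : ℝ) : Prop :=
  ∀ c : M, ∀ x ∈ (extChartAt 𝓘(ℝ, E) c).target, ∀ u v : E,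
    CoordGeom.lieMetric (coordVec V c) (coordMetric g c) x u v
        + 2 * α * CoordGeom.ricci (coordMetric g c) x u v
      = (2 * lam - β * CoordGeom.scalarCurvature (coordMetric g c) x) * coordMetric g c x u v

/-- A proper Ricci–Yamabe soliton: `α ≠ 0, 1`. -/
def IsProperRicciYamabeSoliton (g : RMetric E M) (V : ∀ p : M, TangentSpace 𝓘(ℝ, E) p)
    (lam α β : ℝ) : Prop :=
  IsRicciYamabeSoliton g V lam α β ∧ α ≠ 0 ∧ α ≠ 1

/-- The curvature condition `Q · R = 0` holds on `M`. -/
def SatisfiesQdotR (g : RMetric E M) : Prop :=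
  ∀ c : M, ∀ x ∈ (extChartAt 𝓘(ℝ, E) c).target, CoordGeom.QdotRZero (coordMetric g c) x

end Soliton

/-! ## Almost contact metric structures and almost Kenmotsu manifolds -/

/-- An almost contact metric structure `(φ, ξ, η, g)`, with `η = g(·, ξ)`, on a manifold modelled
on `E`. -/
structure AlmostContactMetric (E : Type*) [NormedAddCommGroup E] [NormedSpace ℝ E]
    (M : Type*) [TopologicalSpace M] [ChartedSpace E M] [IsManifold 𝓘(ℝ, E) ∞ M] where
  /-- the Riemannian metric -/
  g : RMetric E M
  /-- the (1,1)-tensor field -/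
  φ : ∀ p : M, TangentSpace 𝓘(ℝ, E) p →L[ℝ] TangentSpace 𝓘(ℝ, E) p
  /-- the Reeb vector field -/
  ξ : ∀ p : M, TangentSpace 𝓘(ℝ, E) p
  φ_smooth : ContMDiff 𝓘(ℝ, E) (𝓘(ℝ, E).prod 𝓘(ℝ, E →L[ℝ] E)) ∞
    (fun p => Bundle.TotalSpace.mk' (E →L[ℝ] E)
      (E := fun p : M => TangentSpace 𝓘(ℝ, E) p →L[ℝ] TangentSpace 𝓘(ℝ, E) p) p (φ p))
  ξ_smooth : ContMDiff 𝓘(ℝ, E) (𝓘(ℝ, E).prod 𝓘(ℝ, E)) ∞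
    (fun p => Bundle.TotalSpace.mk' E (E := fun p : M => TangentSpace 𝓘(ℝ, E) p) p (ξ p))
  φ_sq : ∀ (p : M) (X : TangentSpace 𝓘(ℝ, E) p), φ p (φ p X) = -X + g.inner p X (ξ p) • ξ p
  η_ξ : ∀ p : M, g.inner p (ξ p) (ξ p) = 1
  φ_ξ : ∀ p : M, φ p (ξ p) = 0
  η_φ : ∀ (p : M) (X : TangentSpace 𝓘(ℝ, E) p), g.inner p (φ p X) (ξ p) = 0
  compat : ∀ (p : M) (X Y : TangentSpace 𝓘(ℝ, E) p),
    g.inner p (φ p X) (φ p Y) = g.inner p X Y - g.inner p X (ξ p) * g.inner p Y (ξ p)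

namespace AlmostContactMetric

variable {E : Type*} [NormedAddCommGroup E] [NormedSpace ℝ E]
  {M : Type*} [TopologicalSpace M] [ChartedSpace E M] [IsManifold 𝓘(ℝ, E) ∞ M]

/-- Coordinate expression of `η = g(·, ξ)`. -/
def coordEta (A : AlmostContactMetric E M) (c : M) (x : E) : E →L[ℝ] ℝ :=
  (coordMetric A.g c x).flip (coordVec A.ξ c x)

/-- Coordinate expression of the fundamental 2-form `Φ(X, Y) = g(X, φ Y)`. -/
def coordPhi (A : AlmostContactMetric E M) (c : M) (x : E) : E →L[ℝ] E →L[ℝ] ℝ :=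
  (ContinuousLinearMap.precomp ℝ (coordEnd A.φ c x)) ∘L coordMetric A.g c x

/-- Coordinate expression of `h = (1/2) £_ξ φ`. -/
def coordH (A : AlmostContactMetric E M) (c : M) (x : E) : E →L[ℝ] E :=
  (1 / 2 : ℝ) • CoordGeom.lieEnd (coordVec A.ξ c) (coordEnd A.φ c) x

/-- Almost Kenmotsu: `dη = 0` and `dΦ = 2 η ∧ Φ`. -/
def IsAlmostKenmotsu (A : AlmostContactMetric E M) : Prop :=
  ∀ c : M, ∀ x ∈ (extChartAt 𝓘(ℝ, E) c).target,
    CoordGeom.IsClosedOneForm (A.coordEta c) x ∧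
    ∀ u v w : E, CoordGeom.extDerivTwo (A.coordPhi c) x u v w
      = 2 * CoordGeom.wedgeOneTwo (A.coordEta c x) (A.coordPhi c x) u v w

/-- `(k, μ)`-almost Kenmotsu: almost Kenmotsu with `ξ` in the `(k, μ)`-nullity distribution, that is
`R(X, Y) ξ = k (η(Y) X - η(X) Y) + μ (η(Y) h X - η(X) h Y)`. -/
def IsKMuAlmostKenmotsu (A : AlmostContactMetric E M) (k μ : ℝ) : Prop :=
  A.IsAlmostKenmotsu ∧
  ∀ c : M, ∀ x ∈ (extChartAt 𝓘(ℝ, E) c).target, ∀ u v : E,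
    CoordGeom.curvature (coordMetric A.g c) x u v (coordVec A.ξ c x)
      = k • (A.coordEta c x v • u - A.coordEta c x u • v)
        + μ • (A.coordEta c x v • A.coordH c x u - A.coordEta c x u • A.coordH c x v)

end AlmostContactMetric

end

/-! Write A = ∇ξ and l = R(·, ξ)ξ. The nullity condition makes ξ an eigenvector of Q, say Qξ = cξ
(`exists_ricci_reeb_eq`), and tr l = S(ξ, ξ) = c. Putting Y = Z = ξ in Q·R = 0 gives Ql - lQ = 2c l;
a commutator has trace zero, so 2c² = 0 (`not_QdotRZero_of_ricci_reeb`).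

On the other hand c < 0 (`ricci_reeb_neg`). Since dη = 0, A is self-adjoint and Aξ = 0. Since dΦ =
2η∧Φ, Aφ + h = φ (`covDeriv_comp_phi`), and composing with φ and taking traces gives tr A = dim M -
1 (`trace_covDeriv`). As ∇_ξ ξ = 0, l = -A² - ∇_ξ A (`curvature_reeb`). The trace of ∇_ξ A is ξ(tr
A) = 0, so c = -tr A², which is negative because A is self-adjoint with nonzero trace.

The argument is local, so it is carried out on an open set of E and then applied in one chart. -/

namespace CoordGeom

variable {E : Type*} [NormedAddCommGroup E] [NormedSpace ℝ E]

/-! ### Traces of endomorphisms of an inner product space -/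

section Trace

variable [FiniteDimensional ℝ E]

theorem exists_orthogonal_basis_trace (B : E →L[ℝ] E →L[ℝ] ℝ) (hs : ∀ u v, B u v = B v u)
    (hp : ∀ u, u ≠ 0 → 0 < B u u) :
    ∃ b : Module.Basis (Fin (Module.finrank ℝ E)) ℝ E,
      ∀ f : E →ₗ[ℝ] E, LinearMap.trace ℝ E f = ∑ i, B (f (b i)) (b i) / B (b i) (b i) := by
  let B' : LinearMap.BilinForm ℝ E := LinearMap.mk₂ ℝ (fun u v => B u v) (by simp) (by simp)
    (by simp) (by simp)
  have hB' : LinearMap.IsSymm B' := ⟨fun u v => hs u v⟩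
  obtain ⟨b, hb⟩ := LinearMap.BilinForm.exists_orthogonal_basis hB'
  refine ⟨b, fun f => ?_⟩
  have hdiag : ∀ (i) (w : E), B w (b i) = b.repr w i * B (b i) (b i) := by
    intro i w
    conv_lhs => rw [← b.sum_repr w]
    simp only [map_sum, map_smul, sum_apply, smul_apply,
      smul_eq_mul]
    rw [Finset.sum_eq_single i]
    · intro j _ hj
      have : B (b j) (b i) = 0 := hb hj
      simp [this]
    · simp
  rw [LinearMap.trace_eq_matrix_trace ℝ b, Matrix.trace]
  refine Finset.sum_congr rfl fun i _ => ?_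
  have hi := hp (b i) (b.ne_zero i)
  rw [Matrix.diag_apply, LinearMap.toMatrix_apply, hdiag, mul_div_cancel_right₀ _ hi.ne']

/-- An endomorphism that is skew-adjoint for an inner product is traceless. -/
theorem trace_eq_zero_of_skew (B : E →L[ℝ] E →L[ℝ] ℝ) (hs : ∀ u v, B u v = B v u)
    (hp : ∀ u, u ≠ 0 → 0 < B u u) (f : E →ₗ[ℝ] E) (hf : ∀ u, B (f u) u = 0) :
    LinearMap.trace ℝ E f = 0 := by
  obtain ⟨b, hb⟩ := exists_orthogonal_basis_trace B hs hp
  simp [hb, hf]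

/-- The square of an endomorphism that is self-adjoint for an inner product and has nonzero trace
has positive trace. -/
theorem trace_mul_self_pos (B : E →L[ℝ] E →L[ℝ] ℝ) (hs : ∀ u v, B u v = B v u)
    (hp : ∀ u, u ≠ 0 → 0 < B u u) (f : E →ₗ[ℝ] E) (hf : ∀ u v, B (f u) v = B u (f v))
    (hf0 : LinearMap.trace ℝ E f ≠ 0) : 0 < LinearMap.trace ℝ E (f * f) := by
  obtain ⟨b, hb⟩ := exists_orthogonal_basis_trace B hs hp
  have hnn : ∀ u, 0 ≤ B u u := fun u => by
    rcases eq_or_ne u 0 with rfl | h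
    · simp
    · exact (hp u h).le
  have hterm : ∀ i, B ((f * f) (b i)) (b i) / B (b i) (b i)
      = B (f (b i)) (f (b i)) / B (b i) (b i) := fun i => by
    rw [Module.End.mul_apply, hf]
  rw [hb]
  simp only [hterm]
  refine Finset.sum_pos' (fun i _ => div_nonneg (hnn _) (hnn _)) ?_
  -- If no summand were positive, f would kill every basis vector and have trace zero.
  by_contra! hcon
  apply hf0
  rw [hb]
  refine Finset.sum_eq_zero fun i hi => ?_
  have h0 : f (b i) = 0 := by
    by_contra h
    exact absurd (div_pos (hp _ h) (hp _ (b.ne_zero i))) (not_lt.mpr (hcon i hi))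
  simp [h0]

end Trace

/-! ### Levi-Civita connection and curvature symmetries in coordinates -/

/-- `G` is a `C²` Riemannian metric on the open set `U`. -/
structure IsMetricOn (U : Set E) (G : E → E →L[ℝ] E →L[ℝ] ℝ) : Prop where
  isOpen : IsOpen U
  contDiffAt : ∀ y ∈ U, ContDiffAt ℝ 2 G y
  symm : ∀ y ∈ U, ∀ u v, G y u v = G y v u
  pos : ∀ y ∈ U, ∀ u, u ≠ 0 → 0 < G y u u

/-- The device by which the structure equations, valid on all of U, are differentiated at a point.
-/
theorem hasFDerivAt_unique_of_eqOn {F : Type*} [NormedAddCommGroup F] [NormedSpace ℝ F]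
    {U : Set E} (hU : IsOpen U) {f g : E → F} {f' g' : E →L[ℝ] F} {x : E} (hx : x ∈ U)
    (hf : HasFDerivAt f f' x) (hg : HasFDerivAt g g' x) (h : ∀ y ∈ U, f y = g y) : f' = g' :=
  (hf.congr_of_eventuallyEq (by
    filter_upwards [hU.mem_nhds hx] with y hy using (h y hy).symm)).unique hg

/-- `R(·, v) w` as a linear map, whose trace is `S(v, w)`. -/
noncomputable def curvatureFst (G : E → E →L[ℝ] E →L[ℝ] ℝ) (x v w : E) : E →ₗ[ℝ] E where
  toFun u := curvature G x u v w
  map_add' a b := by simp only [curvature, map_add, add_apply]; abel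
  map_smul' c a := by
    simp only [curvature, map_smul, smul_apply, RingHom.id_apply, smul_sub,
      smul_add]

theorem ricci_eq_trace (G : E → E →L[ℝ] E →L[ℝ] ℝ) (x v w : E) :
    ricci G x v w = LinearMap.trace ℝ E (curvatureFst G x v w) := rfl

/-- `R(u, v)` as a linear map. -/
noncomputable def curvatureEnd (G : E → E →L[ℝ] E →L[ℝ] ℝ) (x u v : E) : E →ₗ[ℝ] E where
  toFun w := curvature G x u v w
  map_add' a b := by simp only [curvature, map_add]; abel
  map_smul' c a := by simp only [curvature, map_smul, RingHom.id_apply, smul_sub, smul_add]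

namespace IsMetricOn

variable {U : Set E} {G : E → E →L[ℝ] E →L[ℝ] ℝ} {x : E}

theorem hasFDerivAt (hG : IsMetricOn U G) (hx : x ∈ U) : HasFDerivAt G (fderiv ℝ G x) x :=
  ((hG.contDiffAt x hx).differentiableAt (by norm_num)).hasFDerivAt

theorem fderiv_symm (hG : IsMetricOn U G) (hx : x ∈ U) (u v w : E) :
    fderiv ℝ G x u v w = fderiv ℝ G x u w v := by
  have h (a b : E) : HasFDerivAt (fun y => G y a b) _ x :=
    ((hG.hasFDerivAt hx).clm_apply (hasFDerivAt_const a x)).clm_apply (hasFDerivAt_const b x)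
  have := hasFDerivAt_unique_of_eqOn hG.isOpen hx (h v w) (h w v) fun y hy => hG.symm y hy v w
  simpa using DFunLike.congr_fun this u

/-- Positivity gives injectivity, and E and its dual have equal dimension. Without this `(G
x).inverse` would be the default value 0. -/
theorem isInvertible [FiniteDimensional ℝ E] (hG : IsMetricOn U G) (hx : x ∈ U) :
    (G x).IsInvertible := by
  have hinj : Function.Injective (G x : E →ₗ[ℝ] (E →L[ℝ] ℝ)) := by
    rw [← LinearMap.ker_eq_bot, LinearMap.ker_eq_bot']
    intro u hu
    by_contra h
    have := hG.pos x hx u h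
    rw [show G x u = 0 from hu] at this
    simp at this
  have hdim : Module.finrank ℝ E = Module.finrank ℝ (E →L[ℝ] ℝ) := by
    rw [← (LinearMap.toContinuousLinearMap : (E →ₗ[ℝ] ℝ) ≃ₗ[ℝ] (E →L[ℝ] ℝ)).finrank_eq]
    exact (Subspace.dual_finrank_eq (K := ℝ) (V := E)).symm
  exact ⟨(LinearEquiv.ofInjectiveOfFinrankEq _ hinj hdim).toContinuousLinearEquiv, by ext; rfl⟩

theorem inverse_apply [FiniteDimensional ℝ E] (hG : IsMetricOn U G) (hx : x ∈ U)
    (θ : E →L[ℝ] ℝ) : G x ((G x).inverse θ) = θ :=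
  ((hG.isInvertible hx).inverse_apply_eq.1 rfl).symm

theorem ext_inner (hG : IsMetricOn U G) (hx : x ∈ U) {u v : E} (h : ∀ w, G x u w = G x v w) :
    u = v := by
  by_contra hne
  have := hG.pos x hx (u - v) (sub_ne_zero.2 hne)
  simp [h] at this

theorem differentiableAt_fderiv (hG : IsMetricOn U G) (hx : x ∈ U) :
    DifferentiableAt ℝ (fderiv ℝ G) x :=
  ((hG.contDiffAt x hx).fderiv_right (m := 1) (by norm_num)).differentiableAt (by norm_num)

variable [FiniteDimensional ℝ E]

theorem inner_christoffel (hG : IsMetricOn U G) (hx : x ∈ U) (u v w : E) :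
    G x (christoffel G x u v) w =
      (1 / 2 : ℝ) * (fderiv ℝ G x u v w + fderiv ℝ G x v u w - fderiv ℝ G x w u v) := by
  rw [christoffel_apply, hG.inverse_apply hx, christoffelLower_apply]

theorem christoffel_comm (hG : IsMetricOn U G) (hx : x ∈ U) (u v : E) :
    christoffel G x u v = christoffel G x v u := by
  refine hG.ext_inner hx fun w => ?_
  rw [hG.inner_christoffel hx, hG.inner_christoffel hx, hG.fderiv_symm hx w u v]
  ring

/-- The Levi-Civita connection is metric. -/
theorem fderiv_eq (hG : IsMetricOn U G) (hx : x ∈ U) (u v w : E) :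
    fderiv ℝ G x u v w = G x (christoffel G x u v) w + G x v (christoffel G x u w) := by
  rw [hG.symm x hx v, hG.inner_christoffel hx, hG.inner_christoffel hx,
    hG.fderiv_symm hx u w v, hG.fderiv_symm hx w u v, hG.fderiv_symm hx v u w]
  ring

/-- Christoffel symbols involve one derivative of a C² metric and its inverse. This makes the
`fderiv` in `curvature` a genuine derivative. -/
theorem differentiableAt_christoffel (hG : IsMetricOn U G) (hx : x ∈ U) :
    DifferentiableAt ℝ (christoffel G) x := by
  have : CompleteSpace E := FiniteDimensional.complete ℝ E
  have h1 : DifferentiableAt ℝ (fun y => (G y).inverse) x := by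
    obtain ⟨e, he⟩ := hG.isInvertible hx
    have h := (contDiffAt_map_inverse (n := 1) e).differentiableAt (by norm_num)
    rw [he] at h
    exact h.comp x (hG.hasFDerivAt hx).differentiableAt
  have h2 : DifferentiableAt ℝ (christoffelLower G) x := by
    have h := hG.differentiableAt_fderiv hx
    have hflip : DifferentiableAt ℝ (fun y => (fderiv ℝ G y).flip) x :=
      (ContinuousLinearMap.flipₗᵢ ℝ E E (E →L[ℝ] ℝ)).differentiableAt.comp x h
    have h3 : DifferentiableAt ℝ (fun y => fderiv ℝ G y + (fderiv ℝ G y).flip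
        - (ContinuousLinearMap.flipₗᵢ ℝ E E ℝ).toContinuousLinearEquiv.toContinuousLinearMap.comp
          (fderiv ℝ G y).flip) x :=
      (h.add hflip).sub ((differentiableAt_const _).clm_comp hflip)
    exact h3.const_smul (1 / 2 : ℝ)
  exact ((ContinuousLinearMap.differentiableAt _).comp x h1).clm_comp h2

theorem hasFDerivAt_christoffel (hG : IsMetricOn U G) (hx : x ∈ U) :
    HasFDerivAt (christoffel G) (fderiv ℝ (christoffel G) x) x :=
  (hG.differentiableAt_christoffel hx).hasFDerivAt

/-- The curvature operators are skew-adjoint. -/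
theorem inner_curvature_self (hG : IsMetricOn U G) (hx : x ∈ U) (u v w : E) :
    G x (curvature G x u v w) w = 0 := by
  -- Differentiate G(Γ(v, w), w) = ½ ∂_v G(w, w) along u. Antisymmetrising in u and v cancels the
  -- second derivatives of G, and metric compatibility turns the ∂G terms into the quadratic Γ
  -- terms.
  have key (v u : E) : fderiv ℝ G x u (christoffel G x v w) w
      + G x (fderiv ℝ (christoffel G) x u v w) w
      = (1 / 2 : ℝ) * fderiv ℝ (fderiv ℝ G) x u v w w := by
    have h1 : HasFDerivAt (fun y => G y (christoffel G y v w) w) _ x :=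
      ((hG.hasFDerivAt hx).clm_apply (((hG.hasFDerivAt_christoffel hx).clm_apply
        (hasFDerivAt_const v x)).clm_apply (hasFDerivAt_const w x))).clm_apply
        (hasFDerivAt_const w x)
    have h2 : HasFDerivAt (fun y => (1 / 2 : ℝ) * fderiv ℝ G y v w w) _ x :=
      ((((hG.differentiableAt_fderiv hx).hasFDerivAt.clm_apply
        (hasFDerivAt_const v x)).clm_apply (hasFDerivAt_const w x)).clm_apply
        (hasFDerivAt_const w x)).const_mul (1 / 2 : ℝ)
    have := DFunLike.congr_fun (hasFDerivAt_unique_of_eqOn hG.isOpen hx h1 h2 fun y hy => by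
      rw [hG.inner_christoffel hy, hG.fderiv_symm hy w v w]; ring) u
    simp at this
    linarith
  have hsymm : fderiv ℝ (fderiv ℝ G) x u v = fderiv ℝ (fderiv ℝ G) x v u :=
    (hG.contDiffAt x hx).isSymmSndFDerivAt (by simp) u v
  have h1 := key v u
  have h2 := key u v
  rw [hG.fderiv_eq hx] at h1 h2
  have h3 := hG.symm x hx (christoffel G x v w) (christoffel G x u w)
  simp only [curvature, map_sub, map_add, sub_apply,
    add_apply]
  rw [hsymm] at h1
  linarith

theorem fderiv_christoffel_comm (hG : IsMetricOn U G) (hx : x ∈ U) (a u v : E) :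
    fderiv ℝ (christoffel G) x a u v = fderiv ℝ (christoffel G) x a v u := by
  have h (u v : E) : HasFDerivAt (fun y => christoffel G y u v) _ x :=
    ((hG.hasFDerivAt_christoffel hx).clm_apply (hasFDerivAt_const u x)).clm_apply
      (hasFDerivAt_const v x)
  simpa using DFunLike.congr_fun (hasFDerivAt_unique_of_eqOn hG.isOpen hx (h u v) (h v u)
    fun y hy => hG.christoffel_comm hy u v) a

/-- The first Bianchi identity. -/
theorem bianchi (hG : IsMetricOn U G) (hx : x ∈ U) (u v w : E) :
    curvature G x u v w + curvature G x v w u + curvature G x w u v = 0 := by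
  simp only [curvature]
  rw [hG.fderiv_christoffel_comm hx u w v, hG.fderiv_christoffel_comm hx v w u,
    hG.fderiv_christoffel_comm hx w v u, hG.christoffel_comm hx w v, hG.christoffel_comm hx w u,
    hG.christoffel_comm hx v u]
  abel

/-- The Ricci tensor is symmetric. -/
theorem ricci_symm (hG : IsMetricOn U G) (hx : x ∈ U) (v w : E) :
    ricci G x v w = ricci G x w v := by
  -- The Bianchi identity, read as an identity of operators in u; the right side is skew-adjoint,
  -- hence traceless.
  have h : curvatureFst G x v w - curvatureFst G x w v = - curvatureEnd G x v w := by
    ext u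
    have h1 := hG.bianchi hx u v w
    have h2 : curvature G x w u v = - curvature G x u w v := by simp only [curvature]; abel
    rw [h2] at h1
    change curvature G x u v w - curvature G x u w v = - curvature G x v w u
    rw [eq_neg_iff_add_eq_zero, ← h1]
    abel
  have h0 : LinearMap.trace ℝ E (curvatureEnd G x v w) = 0 :=
    trace_eq_zero_of_skew (G x) (hG.symm x hx) (hG.pos x hx) _
      fun u => hG.inner_curvature_self hx v w u
  have := congrArg (LinearMap.trace ℝ E) h
  rw [map_sub, map_neg, h0, neg_zero, sub_eq_zero] at this
  exact this

end IsMetricOn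

/-! ### The trace as a differentiable functional -/

/-- The trace as a continuous linear functional. -/
noncomputable def traceCLM (E : Type*) [NormedAddCommGroup E] [NormedSpace ℝ E]
    [FiniteDimensional ℝ E] : (E →L[ℝ] E) →L[ℝ] ℝ :=
  LinearMap.toContinuousLinearMap (LinearMap.trace ℝ E ∘ₗ ContinuousLinearMap.coeLM ℝ)

section

variable [FiniteDimensional ℝ E]

theorem traceCLM_apply (f : E →L[ℝ] E) :
    traceCLM E f = LinearMap.trace ℝ E (f : E →ₗ[ℝ] E) := rfl

theorem traceCLM_comp_comm (f g : E →L[ℝ] E) : traceCLM E (f ∘L g) = traceCLM E (g ∘L f) :=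
  LinearMap.trace_mul_comm ℝ (f : E →ₗ[ℝ] E) g

/-- Applied to φ² = -id + η ⊗ ξ, it gives tr φ² = 1 - dim. -/
theorem traceCLM_neg_id_add_smulRight (θ : E →L[ℝ] ℝ) (v : E) :
    traceCLM E (-ContinuousLinearMap.id ℝ E + θ.smulRight v) = θ v - Module.finrank ℝ E := by
  rw [map_add, map_neg, traceCLM_apply, traceCLM_apply]
  have h1 : LinearMap.trace ℝ E ((ContinuousLinearMap.id ℝ E : E →L[ℝ] E) : E →ₗ[ℝ] E)
      = Module.finrank ℝ E := LinearMap.trace_id ℝ E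
  have h2 : LinearMap.trace ℝ E ((θ.smulRight v : E →L[ℝ] E) : E →ₗ[ℝ] E) = θ v :=
    LinearMap.trace_smulRight (θ : E →ₗ[ℝ] ℝ) v
  rw [h1, h2]
  ring

end

/-! ### Almost Kenmotsu structures and the Ricci curvature of the Reeb field -/

/-- The covariant derivative `∇V` of a vector field, as an endomorphism field. -/
noncomputable def covDeriv (G : E → E →L[ℝ] E →L[ℝ] ℝ) (V : E → E) (x : E) : E →L[ℝ] E :=
  fderiv ℝ V x + (christoffel G x).flip (V x)

theorem covDeriv_apply (G : E → E →L[ℝ] E →L[ℝ] ℝ) (V : E → E) (x u : E) :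
    covDeriv G V x u = fderiv ℝ V x u + christoffel G x u (V x) := rfl

/-- An almost Kenmotsu structure `(P, V, G)` on the open set `U`, with `η = G(·, V)`. -/
structure IsAlmostKenmotsuOn (U : Set E) (G : E → E →L[ℝ] E →L[ℝ] ℝ) (V : E → E)
    (P : E → E →L[ℝ] E) : Prop extends IsMetricOn U G where
  reeb_contDiffAt : ∀ y ∈ U, ContDiffAt ℝ 2 V y
  phi_contDiffAt : ∀ y ∈ U, ContDiffAt ℝ 2 P y
  phi_sq : ∀ y ∈ U, ∀ u, P y (P y u) = -u + G y u (V y) • V y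
  eta_reeb : ∀ y ∈ U, G y (V y) (V y) = 1
  phi_reeb : ∀ y ∈ U, P y (V y) = 0
  eta_phi : ∀ y ∈ U, ∀ u, G y (P y u) (V y) = 0
  compat : ∀ y ∈ U, ∀ u v, G y (P y u) (P y v) = G y u v - G y u (V y) * G y v (V y)
  closed : ∀ y ∈ U, IsClosedOneForm (fun z => (G z).flip (V z)) y
  extDeriv : ∀ y ∈ U, ∀ u v w,
    extDerivTwo (fun z => (ContinuousLinearMap.precomp ℝ (P z)) ∘L G z) y u v w
      = 2 * wedgeOneTwo ((G y).flip (V y)) ((ContinuousLinearMap.precomp ℝ (P y)) ∘L G y) u v w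

namespace IsAlmostKenmotsuOn

variable {U : Set E} {G : E → E →L[ℝ] E →L[ℝ] ℝ} {V : E → E} {P : E → E →L[ℝ] E} {x : E}

theorem hasFDerivAt_reeb (hK : IsAlmostKenmotsuOn U G V P) (hx : x ∈ U) :
    HasFDerivAt V (fderiv ℝ V x) x :=
  ((hK.reeb_contDiffAt x hx).differentiableAt (by norm_num)).hasFDerivAt

theorem hasFDerivAt_phi (hK : IsAlmostKenmotsuOn U G V P) (hx : x ∈ U) :
    HasFDerivAt P (fderiv ℝ P x) x :=
  ((hK.phi_contDiffAt x hx).differentiableAt (by norm_num)).hasFDerivAt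

/-- Replace v by φv in the compatibility condition; the η terms vanish because η ∘ φ = 0. -/
theorem inner_phi_left (hK : IsAlmostKenmotsuOn U G V P) (hx : x ∈ U) (u v : E) :
    G x (P x u) v = - G x u (P x v) := by
  have h := hK.compat x hx u (P x v)
  rw [hK.phi_sq x hx v, hK.eta_phi x hx v, map_add, map_neg, map_smul, hK.eta_phi x hx u] at h
  simp at h
  linarith

variable [FiniteDimensional ℝ E]

/-- `∇V` is self-adjoint, since `dη = 0`. -/
theorem inner_covDeriv_symm (hK : IsAlmostKenmotsuOn U G V P) (hx : x ∈ U) (u v : E) :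
    G x (covDeriv G V x u) v = G x u (covDeriv G V x v) := by
  have hG := hK.toIsMetricOn
  have hη : fderiv ℝ (fun z => (G z).flip (V z)) x
      = _ := HasFDerivAt.fderiv
    (((ContinuousLinearMap.flipₗᵢ ℝ E E ℝ).toContinuousLinearEquiv.hasFDerivAt.comp x
      (hG.hasFDerivAt hx)).clm_apply (hK.hasFDerivAt_reeb hx))
  have h := hK.closed x hx u v
  rw [hη] at h
  simp at h
  rw [hG.symm x hx u, covDeriv_apply, covDeriv_apply]
  simp only [map_add, add_apply, hG.inner_christoffel hx]
  rw [hG.symm x hx (fderiv ℝ V x u) v, hG.symm x hx (fderiv ℝ V x v) u]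
  rw [hG.fderiv_symm hx u (V x) v, hG.fderiv_symm hx v (V x) u, hG.fderiv_symm hx (V x) u v]
  linarith

/-- The derivative of the constant G(V, V) = 1. -/
theorem inner_covDeriv_reeb (hK : IsAlmostKenmotsuOn U G V P) (hx : x ∈ U) (u : E) :
    G x (covDeriv G V x u) (V x) = 0 := by
  have hG := hK.toIsMetricOn
  have h := DFunLike.congr_fun (hasFDerivAt_unique_of_eqOn hG.isOpen hx
    (((hG.hasFDerivAt hx).clm_apply (hK.hasFDerivAt_reeb hx)).clm_apply (hK.hasFDerivAt_reeb hx))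
    (hasFDerivAt_const (1 : ℝ) x) hK.eta_reeb) u
  simp at h
  rw [covDeriv_apply, map_add, add_apply, hG.inner_christoffel hx]
  rw [hG.symm x hx (V x)] at h
  linarith

/-- By self-adjointness G(∇_V V, w) = G(V, ∇_w V), which is zero since V has unit length. -/
theorem covDeriv_reeb (hK : IsAlmostKenmotsuOn U G V P) (hx : x ∈ U) :
    covDeriv G V x (V x) = 0 :=
  hK.toIsMetricOn.ext_inner hx fun w => by
    rw [hK.inner_covDeriv_symm hx, hK.toIsMetricOn.symm x hx, hK.inner_covDeriv_reeb hx]; simp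

/-- `∇V ∘ φ + h = φ`, with `h = (1/2) £_V φ`. -/
theorem covDeriv_comp_phi (hK : IsAlmostKenmotsuOn U G V P) (hx : x ∈ U) :
    covDeriv G V x ∘L P x + (1 / 2 : ℝ) • lieEnd V P x = P x := by
  have hG := hK.toIsMetricOn
  have hPG : HasFDerivAt (fun z => (ContinuousLinearMap.precomp ℝ (P z)) ∘L G z) _ x :=
    (((ContinuousLinearMap.compL ℝ E E ℝ).flip.hasFDerivAt).comp x
      (hK.hasFDerivAt_phi hx)).clm_comp (hG.hasFDerivAt hx)
  have hPGv (a u v : E) : fderiv ℝ (fun z => (ContinuousLinearMap.precomp ℝ (P z)) ∘L G z) x a u v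
      = fderiv ℝ G x a u (P x v) + G x u (fderiv ℝ P x a v) := by
    rw [hPG.fderiv]
    simp
  -- `hR` differentiates φξ = 0, and `hL` differentiates η ∘ φ = 0.
  have hR (v : E) : P x (fderiv ℝ V x v) = - fderiv ℝ P x v (V x) := by
    have := DFunLike.congr_fun (hasFDerivAt_unique_of_eqOn hG.isOpen hx
      ((hK.hasFDerivAt_phi hx).clm_apply (hK.hasFDerivAt_reeb hx))
      (hasFDerivAt_const (0 : E) x) hK.phi_reeb) v
    simp at this
    exact eq_neg_of_add_eq_zero_left this
  have hL (w v : E) : fderiv ℝ G x w (V x) (P x v) + G x (V x) (fderiv ℝ P x w v)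
      = - G x (fderiv ℝ V x w) (P x v) := by
    have := DFunLike.congr_fun (hasFDerivAt_unique_of_eqOn hG.isOpen hx
      (((hG.hasFDerivAt hx).clm_apply (hK.hasFDerivAt_reeb hx)).clm_apply
        ((hK.hasFDerivAt_phi hx).clm_apply (hasFDerivAt_const v x)))
      (hasFDerivAt_const (0 : ℝ) x) fun y hy => by
        rw [hG.symm y hy]; exact hK.eta_phi y hy v) w
    simp at this
    linarith
  ext w
  refine hG.ext_inner hx fun v => ?_
  -- With ξ in the first slot, (η∧Φ)(ξ, v, w) reduces to Φ(v, w), as φξ = 0 and η ∘ φ = 0. The rest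
  -- is linear algebra with the self-adjointness of ∇V (`h5`).
  have h := hK.extDeriv x hx (V x) v w
  simp only [extDerivTwo, wedgeOneTwo, hPGv, hL] at h
  simp [hK.phi_reeb x hx, hK.eta_reeb x hx] at h
  have h1 := congrArg (G x w) (hR v)
  have h2 : G x (V x) (P x v) = 0 := by rw [hG.symm x hx, hK.eta_phi x hx]
  rw [h2, mul_zero] at h
  have h3 := hK.inner_phi_left hx w (fderiv ℝ V x v)
  have h4 := hG.symm x hx (P x w) (fderiv ℝ V x v)
  have h5 := hK.inner_covDeriv_symm hx (P x w) v
  have h6 : G x (covDeriv G V x (P x w)) v = G x (fderiv ℝ V x (P x w)) v + (1 / 2 : ℝ) *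
      (fderiv ℝ G x (P x w) (V x) v + fderiv ℝ G x (V x) (P x w) v
        - fderiv ℝ G x v (P x w) (V x)) := by
    rw [covDeriv_apply, map_add, add_apply, hG.inner_christoffel hx]
  have h7 : G x (P x w) (covDeriv G V x v) = G x (fderiv ℝ V x v) (P x w) + (1 / 2 : ℝ) *
      (fderiv ℝ G x v (V x) (P x w) + fderiv ℝ G x (V x) v (P x w)
        - fderiv ℝ G x (P x w) v (V x)) := by
    rw [hG.symm x hx, covDeriv_apply, map_add, add_apply, hG.inner_christoffel hx]
  have h8 := hG.fderiv_symm hx v (V x) (P x w)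
  have h9 := hG.fderiv_symm hx (P x w) (V x) v
  have h10 := hG.fderiv_symm hx (V x) (P x w) v
  have h11 := hG.symm x hx v (P x w)
  simp only [lieEnd, add_apply, sub_apply, smul_apply, ContinuousLinearMap.comp_apply, map_add,
    map_sub, map_smul, smul_eq_mul]
  rw [hG.symm x hx (fderiv ℝ P x (V x) w) v, hK.inner_phi_left hx (fderiv ℝ V x w) v]
  rw [map_neg] at h1
  linarith

/-- The Reeb field has divergence `dim - 1`. -/
theorem trace_covDeriv (hK : IsAlmostKenmotsuOn U G V P) (hx : x ∈ U) :
    traceCLM E (covDeriv G V x) = Module.finrank ℝ E - 1 := by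
  have hG := hK.toIsMetricOn
  have hsq : ∀ y ∈ U, P y ∘L P y
      = -ContinuousLinearMap.id ℝ E + ((G y).flip (V y)).smulRight (V y) := fun y hy => by
    ext u; simpa using hK.phi_sq y hy u
  have htr : ∀ y ∈ U, traceCLM E (P y ∘L P y) = 1 - Module.finrank ℝ E := fun y hy => by
    rw [hsq y hy, traceCLM_neg_id_add_smulRight, ContinuousLinearMap.flip_apply,
      hK.eta_reeb y hy]
  -- The derivative of the constant tr φ² along ξ is twice this trace.
  have hD : traceCLM E (fderiv ℝ P x (V x) ∘L P x) = 0 := by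
    have h := DFunLike.congr_fun (hasFDerivAt_unique_of_eqOn hG.isOpen hx
      ((traceCLM E).hasFDerivAt.comp x ((hK.hasFDerivAt_phi hx).clm_comp (hK.hasFDerivAt_phi hx)))
      (hasFDerivAt_const (1 - Module.finrank ℝ E : ℝ) x) htr) (V x)
    simp at h
    rw [traceCLM_comp_comm (P x)] at h
    linarith
  have hL : traceCLM E (lieEnd V P x ∘L P x) = 0 := by
    have h : lieEnd V P x ∘L P x = fderiv ℝ P x (V x) ∘L P x
        - (fderiv ℝ V x ∘L P x) ∘L P x + P x ∘L (fderiv ℝ V x ∘L P x) := by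
      ext u; simp [lieEnd]
    rw [h, map_add, map_sub, hD, traceCLM_comp_comm (P x)]
    ring
  -- Compose ∇V ∘ φ + h = φ with φ on the right; (∇V)φ² = -∇V because (∇V)ξ = 0.
  have h1 : covDeriv G V x = (1 / 2 : ℝ) • (lieEnd V P x ∘L P x) - P x ∘L P x := by
    have h : covDeriv G V x ∘L (P x ∘L P x) = - covDeriv G V x := by
      rw [hsq x hx]; ext u; simp [hK.covDeriv_reeb hx]
    have h2 := congrArg (fun T => T ∘L P x) (hK.covDeriv_comp_phi hx)
    simp only [ContinuousLinearMap.add_comp, ContinuousLinearMap.smul_comp,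
      ContinuousLinearMap.comp_assoc, h] at h2
    rw [← h2]; abel
  rw [h1, map_sub, map_smul, hL, htr x hx]
  simp

theorem differentiableAt_covDeriv (hK : IsAlmostKenmotsuOn U G V P) (hx : x ∈ U) :
    DifferentiableAt ℝ (covDeriv G V) x := by
  have h1 : DifferentiableAt ℝ (fderiv ℝ V) x :=
    ((hK.reeb_contDiffAt x hx).fderiv_right (m := 1) (by norm_num)).differentiableAt (by norm_num)
  have h2 : DifferentiableAt ℝ (fun y => (christoffel G y).flip) x :=
    (ContinuousLinearMap.flipₗᵢ ℝ E E E).differentiableAt.comp x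
      (hK.toIsMetricOn.differentiableAt_christoffel hx)
  exact h1.add (h2.clm_apply (hK.hasFDerivAt_reeb hx).differentiableAt)

/-- The Jacobi operator `R(·, V) V` is `-(∇V)² - ∇_V (∇V)`. -/
theorem curvature_reeb (hK : IsAlmostKenmotsuOn U G V P) (hx : x ∈ U) (u : E) :
    curvature G x u (V x) (V x) = - covDeriv G V x (covDeriv G V x u)
      - (fderiv ℝ (covDeriv G V) x (V x) u + christoffel G x (V x) (covDeriv G V x u)
        - covDeriv G V x (christoffel G x (V x) u)) := by
  have hG := hK.toIsMetricOn
  have hV2 : HasFDerivAt (fderiv ℝ V) (fderiv ℝ (fderiv ℝ V) x) x :=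
    (((hK.reeb_contDiffAt x hx).fderiv_right (m := 1) (by norm_num)).differentiableAt
      (by norm_num)).hasFDerivAt
  have hD : HasFDerivAt (covDeriv G V) _ x := hV2.add
    (((ContinuousLinearMap.flipₗᵢ ℝ E E E).toContinuousLinearEquiv.hasFDerivAt.comp x
      (hG.hasFDerivAt_christoffel hx)).clm_apply (hK.hasFDerivAt_reeb hx))
  have hDv (a b : E) : fderiv ℝ (covDeriv G V) x a b = fderiv ℝ (fderiv ℝ V) x a b
      + christoffel G x b (fderiv ℝ V x a) + fderiv ℝ (christoffel G) x a b (V x) := by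
    rw [hD.fderiv]; simp [add_assoc]
  have hsymm : fderiv ℝ (fderiv ℝ V) x u (V x) = fderiv ℝ (fderiv ℝ V) x (V x) u :=
    (hK.reeb_contDiffAt x hx).isSymmSndFDerivAt (by simp) u (V x)
  -- Differentiating ∇_V V = 0 along u removes the term ∇_u ∇_V V from the curvature.
  have h0 := DFunLike.congr_fun (hasFDerivAt_unique_of_eqOn hG.isOpen hx
    ((hK.differentiableAt_covDeriv hx).hasFDerivAt.clm_apply (hK.hasFDerivAt_reeb hx))
    (hasFDerivAt_const (0 : E) x) fun y hy => hK.covDeriv_reeb hy) u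
  simp only [add_apply, ContinuousLinearMap.comp_apply, ContinuousLinearMap.flip_apply,
    hDv, zero_apply] at h0
  rw [hDv, curvature, hG.christoffel_comm hx (V x) u, covDeriv_apply G V x u, map_add, map_add]
  have hV : christoffel G x u (fderiv ℝ V x (V x))
      = - christoffel G x u (christoffel G x (V x) (V x)) := by
    have := hK.covDeriv_reeb hx
    rw [covDeriv_apply] at this
    rw [eq_neg_of_add_eq_zero_left this, map_neg]
  rw [hV, eq_neg_of_add_eq_zero_left h0, hsymm]
  abel

/-- `S(V, V) < 0` on an almost Kenmotsu manifold of dimension at least two. -/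
theorem ricci_reeb_neg (hK : IsAlmostKenmotsuOn U G V P) (hx : x ∈ U)
    (hdim : 1 < Module.finrank ℝ E) : ricci G x (V x) (V x) < 0 := by
  have hG := hK.toIsMetricOn
  set A := covDeriv G V x
  -- The trace of ∇V is constant on U. The remaining part of ∇_V A is the commutator of Γ(V, ·) with
  -- A, also traceless.
  have h0 : traceCLM E (fderiv ℝ (covDeriv G V) x (V x)) = 0 := by
    have := DFunLike.congr_fun (hasFDerivAt_unique_of_eqOn hG.isOpen hx
      ((traceCLM E).hasFDerivAt.comp x (hK.differentiableAt_covDeriv hx).hasFDerivAt)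
      (hasFDerivAt_const (Module.finrank ℝ E - 1 : ℝ) x) fun y hy => hK.trace_covDeriv hy) (V x)
    simpa using this
  have h1 : curvatureFst G x (V x) (V x)
      = (-(A ∘L A) - (fderiv ℝ (covDeriv G V) x (V x) + christoffel G x (V x) ∘L A
        - A ∘L christoffel G x (V x)) : E →L[ℝ] E) := by
    ext u; exact hK.curvature_reeb hx u
  have h2 : 0 < traceCLM E (A ∘L A) :=
    trace_mul_self_pos (G x) (hG.symm x hx) (hG.pos x hx) (A : E →ₗ[ℝ] E)
      (hK.inner_covDeriv_symm hx) (by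
        rw [← traceCLM_apply, hK.trace_covDeriv hx, sub_ne_zero]
        exact_mod_cast hdim.ne')
  rw [ricci_eq_trace, h1, ← traceCLM_apply, map_sub, map_neg, map_sub, map_add, h0,
    traceCLM_comp_comm A (christoffel G x (V x))]
  linarith

/-- If `V` is an eigenvector of the Ricci operator, then `Q · R ≠ 0`. -/
theorem not_QdotRZero_of_ricci_reeb (hK : IsAlmostKenmotsuOn U G V P) (hx : x ∈ U)
    (hdim : 1 < Module.finrank ℝ E) {c : ℝ} (hc : ∀ v, ricci G x (V x) v = c * G x (V x) v) :
    ¬ QdotRZero G x := by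
  intro hQR
  have hG := hK.toIsMetricOn
  have hQV : ricciOp G x (V x) = c • V x := by
    refine (hG.isInvertible hx).inverse_apply_eq.2 ?_
    ext v
    simpa using hc v
  set l := curvatureFst G x (V x) (V x)
  have htr : LinearMap.trace ℝ E l = c := by
    rw [← ricci_eq_trace, hc, hK.eta_reeb x hx, mul_one]
  have hneg := hK.ricci_reeb_neg hx hdim
  rw [hc, hK.eta_reeb x hx, mul_one] at hneg
  -- Q·R = 0 on (u, ξ, ξ): the last two terms each contribute c l.
  have h : ricciOp G x * l - l * ricciOp G x = (2 * c) • l := by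
    ext u
    have h := hQR u (V x) (V x)
    have h1 : curvature G x u (c • V x) (V x) = c • curvature G x u (V x) (V x) := by
      simp only [curvature, map_smul, smul_apply, smul_sub, smul_add]
    have h2 : curvature G x u (V x) (c • V x) = c • curvature G x u (V x) (V x) := by
      simp only [curvature, map_smul, smul_sub, smul_add]
    rw [hQV, h1, h2, sub_sub, sub_eq_zero, ← add_smul, ← two_mul] at h
    exact h
  have h' := congrArg (LinearMap.trace ℝ E) h
  rw [map_sub, LinearMap.trace_mul_comm, sub_self, map_smul, htr, smul_eq_mul] at h'
  nlinarith

/-- In the `(k, μ)` case `V` is an eigenvector of the Ricci operator. -/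
theorem exists_ricci_reeb_eq (hK : IsAlmostKenmotsuOn U G V P) (hx : x ∈ U) {k μ : ℝ}
    (hkμ : ∀ u v, curvature G x u v (V x) = k • (G x v (V x) • u - G x u (V x) • v)
      + μ • (G x v (V x) • ((1 / 2 : ℝ) • lieEnd V P x) u
        - G x u (V x) • ((1 / 2 : ℝ) • lieEnd V P x) v)) :
    ∃ c : ℝ, ∀ v, ricci G x (V x) v = c * G x (V x) v := by
  have hG := hK.toIsMetricOn
  set h := (1 / 2 : ℝ) • lieEnd V P x with hh
  -- Both terms of h = φ - ∇V ∘ φ take values orthogonal to ξ.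
  have hηh (v : E) : G x (h v) (V x) = 0 := by
    have := hK.covDeriv_comp_phi hx
    rw [← hh, ← eq_sub_iff_add_eq'] at this
    rw [this]
    simp [hK.eta_phi x hx, hK.inner_covDeriv_reeb hx]
  -- The trace over u of the nullity condition. The value of tr h is not needed, since the sign of
  -- the eigenvalue comes from `ricci_reeb_neg`.
  refine ⟨k * (Module.finrank ℝ E - 1) + μ * traceCLM E h, fun v => ?_⟩
  have h1 : curvatureFst G x v (V x)
      = (k • (G x v (V x) • ContinuousLinearMap.id ℝ E - ((G x).flip (V x)).smulRight v)
        + μ • (G x v (V x) • h - ((G x).flip (V x)).smulRight (h v)) : E →L[ℝ] E) := by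
    ext u; exact hkμ u v
  have htr (w : E) : traceCLM E (((G x).flip (V x)).smulRight w) = G x w (V x) :=
    LinearMap.trace_smulRight ((G x).flip (V x) : E →ₗ[ℝ] ℝ) w
  have hid : traceCLM E (ContinuousLinearMap.id ℝ E) = Module.finrank ℝ E :=
    LinearMap.trace_id ℝ E
  rw [hG.ricci_symm hx, ricci_eq_trace, h1, ← traceCLM_apply]
  simp only [map_add, map_smul, map_sub, htr, hid, hηh, smul_eq_mul]
  rw [hG.symm x hx (V x) v]
  ring

end IsAlmostKenmotsuOn

end CoordGeom

/-! ### From the manifold to coordinates -/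

section ChartCoordinates

variable {E : Type*} [NormedAddCommGroup E] [NormedSpace ℝ E]
  {M : Type*} [TopologicalSpace M] [ChartedSpace E M] [IsManifold 𝓘(ℝ, E) ∞ M]

theorem chartPoint_mem_baseSet {c : M} {x : E} (hx : x ∈ (extChartAt 𝓘(ℝ, E) c).target) :
    chartPoint c x ∈ (trivializationAt E (TangentSpace 𝓘(ℝ, E)) c).baseSet := by
  have := (extChartAt 𝓘(ℝ, E) c).map_target hx
  rwa [extChartAt_source] at this

/-- The bridge from smoothness of sections, tested in trivializations, to smoothness of coordinate
expressions. -/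
theorem toCoord_eq {c : M} {x : E} (hx : x ∈ (extChartAt 𝓘(ℝ, E) c).target) :
    toCoord c x = (trivializationAt E (TangentSpace 𝓘(ℝ, E)) c).continuousLinearMapAt ℝ
      (chartPoint c x) :=
  (TangentBundle.continuousLinearMapAt_trivializationAt (chartPoint_mem_baseSet hx)).symm

theorem toCoord_fromCoord {c : M} {x : E} (hx : x ∈ (extChartAt 𝓘(ℝ, E) c).target) (u : E) :
    toCoord c x (fromCoord c x u) = u := by
  have h := mfderiv_extChartAt_comp_mfderivWithin_extChartAt_symm (I := 𝓘(ℝ, E)) hx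
  rw [modelWithCornersSelf_coe, Set.range_id, mfderivWithin_univ] at h
  exact DFunLike.congr_fun h u

theorem fromCoord_apply {c : M} {x : E} (hx : x ∈ (extChartAt 𝓘(ℝ, E) c).target) (u : E) :
    fromCoord c x u = (trivializationAt E (TangentSpace 𝓘(ℝ, E)) c).symm (chartPoint c x) u := by
  have h := (trivializationAt E (TangentSpace 𝓘(ℝ, E)) c).symmL_continuousLinearMapAt (R := ℝ)
    (chartPoint_mem_baseSet hx) (fromCoord c x u)
  rw [← toCoord_eq hx, toCoord_fromCoord hx,
    Bundle.Trivialization.symmL_apply _ (chartPoint_mem_baseSet hx)] at h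
  exact h.symm

theorem fromCoord_toCoord {c : M} {x : E} (hx : x ∈ (extChartAt 𝓘(ℝ, E) c).target)
    (v : TangentSpace 𝓘(ℝ, E) (chartPoint c x)) : fromCoord c x (toCoord c x v) = v := by
  rw [fromCoord_apply hx, toCoord_eq hx]
  rw [← Bundle.Trivialization.symmL_apply (R := ℝ) _ (chartPoint_mem_baseSet hx)]
  exact (trivializationAt E (TangentSpace 𝓘(ℝ, E)) c).symmL_continuousLinearMapAt (R := ℝ)
    (chartPoint_mem_baseSet hx) v

theorem contDiffAt_comp_chartPoint {F : Type*} [NormedAddCommGroup F] [NormedSpace ℝ F]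
    {f : M → F} {c : M} {x : E} (hx : x ∈ (extChartAt 𝓘(ℝ, E) c).target)
    (hf : ContMDiffAt 𝓘(ℝ, E) 𝓘(ℝ, F) ∞ f (chartPoint c x)) :
    ContDiffAt ℝ ∞ (fun y => f (chartPoint c y)) x :=
  contMDiffAt_iff_contDiffAt.1 (hf.comp x ((contMDiffOn_extChartAt_symm c).contMDiffAt
    ((isOpen_extChartAt_target c).mem_nhds hx)))

theorem coordVec_contDiffAt {V : ∀ p : M, TangentSpace 𝓘(ℝ, E) p}
    (hV : ContMDiff 𝓘(ℝ, E) (𝓘(ℝ, E).prod 𝓘(ℝ, E)) ∞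
      (fun p => Bundle.TotalSpace.mk' E (E := fun p : M => TangentSpace 𝓘(ℝ, E) p) p (V p)))
    {c : M} {x : E} (hx : x ∈ (extChartAt 𝓘(ℝ, E) c).target) :
    ContDiffAt ℝ ∞ (coordVec V c) x := by
  have h := contDiffAt_comp_chartPoint hx
    (((trivializationAt E (TangentSpace 𝓘(ℝ, E)) c).contMDiffAt_section_iff
      (chartPoint_mem_baseSet hx)).1 (hV (chartPoint c x)))
  refine h.congr_of_eventuallyEq ?_
  filter_upwards [(isOpen_extChartAt_target c).mem_nhds hx] with y hy
  rw [coordVec, toCoord_eq hy]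
  exact Bundle.Trivialization.continuousLinearMapAt_apply_of_mem ℝ _ (chartPoint_mem_baseSet hy) _

theorem coordEnd_contDiffAt
    {P : ∀ p : M, TangentSpace 𝓘(ℝ, E) p →L[ℝ] TangentSpace 𝓘(ℝ, E) p}
    (hP : ContMDiff 𝓘(ℝ, E) (𝓘(ℝ, E).prod 𝓘(ℝ, E →L[ℝ] E)) ∞
      (fun p => Bundle.TotalSpace.mk' (E →L[ℝ] E)
        (E := fun p : M => TangentSpace 𝓘(ℝ, E) p →L[ℝ] TangentSpace 𝓘(ℝ, E) p) p (P p)))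
    {c : M} {x : E} (hx : x ∈ (extChartAt 𝓘(ℝ, E) c).target) :
    ContDiffAt ℝ ∞ (coordEnd P c) x := by
  have h := contDiffAt_comp_chartPoint hx
    (((trivializationAt (E →L[ℝ] E) (fun p : M => TangentSpace 𝓘(ℝ, E) p →L[ℝ]
      TangentSpace 𝓘(ℝ, E) p) c).contMDiffAt_section_iff
      ⟨chartPoint_mem_baseSet hx, chartPoint_mem_baseSet hx⟩).1 (hP (chartPoint c x)))
  refine h.congr_of_eventuallyEq ?_
  filter_upwards [(isOpen_extChartAt_target c).mem_nhds hx] with y hy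
  rw [hom_trivializationAt_apply,
    ContinuousLinearMap.inCoordinates_eq (chartPoint_mem_baseSet hy) (chartPoint_mem_baseSet hy)]
  ext u
  simp only [coordEnd, ContinuousLinearMap.comp_apply]
  rw [fromCoord_apply hy, toCoord_eq hy]
  exact Bundle.Trivialization.continuousLinearMapAt_apply_of_mem ℝ _ (chartPoint_mem_baseSet hy) _

theorem coordMetric_contDiffAt (g : RMetric E M) {c : M} {x : E}
    (hx : x ∈ (extChartAt 𝓘(ℝ, E) c).target) : ContDiffAt ℝ ∞ (coordMetric g c) x := by
  have h := contDiffAt_comp_chartPoint hx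
    (((trivializationAt (E →L[ℝ] E →L[ℝ] ℝ) (fun p : M => TangentSpace 𝓘(ℝ, E) p →L[ℝ]
      TangentSpace 𝓘(ℝ, E) p →L[ℝ] Bundle.Trivial M ℝ p) c).contMDiffAt_section_iff
      ⟨chartPoint_mem_baseSet hx, chartPoint_mem_baseSet hx, Set.mem_univ _⟩).1
      (g.contMDiff (chartPoint c x)))
  refine h.congr_of_eventuallyEq ?_
  filter_upwards [(isOpen_extChartAt_target c).mem_nhds hx] with y hy
  rw [hom_trivializationAt_apply]
  ext u v
  rw [inCoordinates_apply_eq₂ (chartPoint_mem_baseSet hy) (chartPoint_mem_baseSet hy)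
    (Set.mem_univ _), coordMetric, coordBilin_apply, fromCoord_apply hy, fromCoord_apply hy]
  simp

theorem coordMetric_apply_coordVec (g : RMetric E M) (V : ∀ p : M, TangentSpace 𝓘(ℝ, E) p)
    {c : M} {x : E} (hx : x ∈ (extChartAt 𝓘(ℝ, E) c).target) (u : E) :
    coordMetric g c x u (coordVec V c x)
      = g.inner (chartPoint c x) (fromCoord c x u) (V (chartPoint c x)) := by
  rw [coordMetric, coordBilin_apply, coordVec, fromCoord_toCoord hx]

theorem fromCoord_coordEnd (P : ∀ p : M, TangentSpace 𝓘(ℝ, E) p →L[ℝ] TangentSpace 𝓘(ℝ, E) p)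
    {c : M} {x : E} (hx : x ∈ (extChartAt 𝓘(ℝ, E) c).target) (u : E) :
    fromCoord c x (coordEnd P c x u) = P (chartPoint c x) (fromCoord c x u) :=
  fromCoord_toCoord hx _

/-- The algebraic identities transfer because `toCoord` and `fromCoord` are mutually inverse over
the chart target; the two differential conditions are already stated in charts. -/
theorem AlmostContactMetric.isAlmostKenmotsuOn {A : AlmostContactMetric E M}
    (hA : A.IsAlmostKenmotsu) (c : M) :
    CoordGeom.IsAlmostKenmotsuOn (extChartAt 𝓘(ℝ, E) c).target (coordMetric A.g c)
      (coordVec A.ξ c) (coordEnd A.φ c) where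
  isOpen := isOpen_extChartAt_target c
  contDiffAt y hy := (coordMetric_contDiffAt A.g hy).of_le ENat.LEInfty.out
  symm y hy u v := A.g.symm _ _ _
  pos y hy u hu := A.g.pos _ _ fun h => hu
    (((toCoord_fromCoord hy u).symm.trans (congrArg (toCoord c y) h)).trans (map_zero _))
  reeb_contDiffAt y hy := (coordVec_contDiffAt A.ξ_smooth hy).of_le ENat.LEInfty.out
  phi_contDiffAt y hy := (coordEnd_contDiffAt A.φ_smooth hy).of_le ENat.LEInfty.out
  phi_sq y hy u := by
    rw [coordMetric_apply_coordVec A.g A.ξ hy]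
    change toCoord c y (A.φ _ (fromCoord c y (coordEnd A.φ c y u))) = _
    rw [fromCoord_coordEnd A.φ hy, A.φ_sq, map_add, map_neg, map_smul, toCoord_fromCoord hy]
    rfl
  eta_reeb y hy := by
    rw [coordMetric_apply_coordVec A.g A.ξ hy, coordVec, fromCoord_toCoord hy, A.η_ξ]
  phi_reeb y hy := by
    change toCoord c y (A.φ _ (fromCoord c y (toCoord c y _))) = 0
    rw [fromCoord_toCoord hy, A.φ_ξ, map_zero]
  eta_phi y hy u := by
    rw [coordMetric_apply_coordVec A.g A.ξ hy, fromCoord_coordEnd A.φ hy, A.η_φ]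
  compat y hy u v := by
    rw [coordMetric_apply_coordVec A.g A.ξ hy, coordMetric_apply_coordVec A.g A.ξ hy, coordMetric,
      coordBilin_apply, fromCoord_coordEnd A.φ hy, fromCoord_coordEnd A.φ hy, A.compat]
    rfl
  closed y hy := (hA c y hy).1
  extDeriv y hy := (hA c y hy).2

/-- A `(k, μ)`-almost Kenmotsu manifold of dimension at least two never satisfies `Q · R = 0`:
with `l = R(·, ξ) ξ` and `Q ξ = c ξ`, the condition gives `Q l - l Q = 2 c l`, so `c ^ 2 = 0` on
taking traces, while `c = S(ξ, ξ) = -tr (∇ξ)² < 0`. No soliton equation is needed. -/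
theorem AlmostContactMetric.IsKMuAlmostKenmotsu.not_satisfiesQdotR [FiniteDimensional ℝ E]
    [Nonempty M] {A : AlmostContactMetric E M} {k μ : ℝ} (hA : A.IsKMuAlmostKenmotsu k μ)
    (hdim : 1 < Module.finrank ℝ E) : ¬ SatisfiesQdotR A.g := by
  intro hQR
  obtain ⟨p⟩ := ‹Nonempty M›
  have hx := mem_extChartAt_target (I := 𝓘(ℝ, E)) p
  have hK := AlmostContactMetric.isAlmostKenmotsuOn hA.1 p
  obtain ⟨c, hc⟩ := hK.exists_ricci_reeb_eq hx fun u v => hA.2 p _ hx u v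
  exact hK.not_QdotRZero_of_ricci_reeb hx hdim hc (hQR p _ hx)

end ChartCoordinates

theorem theorem4p3 (n : ℕ) (hn : 1 ≤ n)
    {M : Type*} [TopologicalSpace M] [ChartedSpace (EuclideanSpace ℝ (Fin (2 * n + 1))) M]
    [IsManifold 𝓘(ℝ, EuclideanSpace ℝ (Fin (2 * n + 1))) ∞ M] [Nonempty M]
    (A : AlmostContactMetric (EuclideanSpace ℝ (Fin (2 * n + 1))) M)
    (k μ : ℝ) (hA : A.IsKMuAlmostKenmotsu k μ)
    (lam α β : ℝ) (hsol : IsProperRicciYamabeSoliton A.g A.ξ lam α β) :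
    ¬ SatisfiesQdotR A.g := by
  -- Here n ≥ 1 matters: in dimension one tr ∇ξ = dim - 1 would vanish and the strict sign would be
  -- lost.
  exact hA.not_satisfiesQdotR (by rw [finrank_euclideanSpace_fin]; omega)
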